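/- Let $q$ be a prime power, let $0\le u_1,u_2<k$ be integers with $(q,k,u_1,u_2)\neq(2,2,1,1)$, and let $S_{u_1},S_{u_2}\subseteq\mathbb F_q^k$ be subspaces of dimensions $u_1$ and $u_2$ with $S_{u_1}\cap S_{u_2}=\{0\}$. Let $C$ be the linear code over $\mathbb F_q$ spanned by the rows of a matrix $G$ whose columns are the vectors of $\mathbb F_q^k\setminus(S_{u_1}\cup S_{u_2})$, each occurring exactly once, in any order. Then $C$ has length $n=q^k-q^{u_1}-q^{u_2}+1$ and dimension $k$. The support weight $\chi(D)$ of a subcode $D\subseteq C$ is the number of coordinates at which some codeword of $D$ is nonzero. Let $A^{(j)}_i$ be the number of $j$-dimensional subcodes $D\subseteq C$ with $\chi(D)=i$, let $d_j(C)$ be the minimum of $\chi(D)$ over all $j$-dimensional subcodes $D\subseteq C$, and call $\{d_j(C): 1\le j\le\dim C\}$ the weight hierarchy of $C$. Let $$\begin{bmatrix}a\\ b\end{bmatrix}=\prod_{i=0}^{b-1}\frac{q^a-q^i}{q^b-q^i}\quad(b\ge0)$$ be the Gaussian coefficient (equal to $1$ for $b=0$, and taken to be $0$ for $b<0$), and put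 $$N(k,m,u_1,u_2,t_1,t_2)=\sum_{t=0}^{\min\{u_1-t_1,\,u_2-t_2\}}q^{(u_1+u_2-t-t_1-t_2)(m-t-t_1-t_2)}\,N_t(u_1,u_2,t_1,t_2)\begin{bmatrix}k-u_1-u_2\\ m-t-t_1-t_2\end{bmatrix},$$ $$N_t(u_1,u_2,t_1,t_2)=\prod_{i=0}^{t-1}(q^t-q^i)\cdot\begin{bmatrix}u_1-t_1\\ t\end{bmatrix}\begin{bmatrix}u_2-t_2\\ t\end{bmatrix}\begin{bmatrix}u_1\\ t_1\end{bmatrix}\begin{bmatrix}u_2\\ t_2\end{bmatrix},$$ with $N(k,m,u_1,u_2,t_1,t_2)=0$ if $t_1>u_1$ or $t_2>u_2$. Then for all $1\le j\le k$ and $0\le i\le n$ the $j$-th support weight distribution is given as follows. If $n-i=q^{k-j}-q^{t_1}-q^{t_2}+1$ for some integers $t_1,t_2$ with $\max\{0,u_r-j\}\le t_r\le u_r$ for $r=1,2$, then $$A^{(j)}_i=\begin{cases}N(k,k-j,u_1,u_2,t_1,t_2)+N(k,k-j,u_1,u_2,t_2,t_1),& t_1\ne t_2,\\ N(k,k-j,u_1,u_2,t_1,t_2),&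 t_1=t_2,\end{cases}$$ and if there are no such $t_1,t_2$, then $A^{(j)}_i=0$. Moreover, $C$ has the weight hierarchy $\{d_1(C),\dots,d_k(C)\}$, where for $1\le j\le k$ $$d_j(C)=q^k-q^{u_1}-q^{u_2}-q^{k-j}+e_1+e_2,\qquad e_r=\begin{cases}q^{u_r-j},& j<u_r,\\ 1,& j\ge u_r\end{cases}\quad(r=1,2).$$ -/

import Mathlib

namespace SolomonStiffler

/-- The columns of `G` are exactly the elements of the set `T`, each occurring once
(in an arbitrary order): `G` is a matrix `[T]`. -/
def IsMatrixOfSet {F : Type*} {k n : ℕ} (G : Matrix (Fin k) (Fin n) F)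
    (T : Set (Fin k → F)) : Prop :=
  Set.BijOn (fun c : Fin n => fun r : Fin k => G r c) Set.univ T

/-- The linear code generated by the rows of `G`. -/
def rowCode {F : Type*} [Field F] {k n : ℕ} (G : Matrix (Fin k) (Fin n) F) :
    Submodule F (Fin n → F) :=
  Submodule.span F (Set.range fun r : Fin k => fun c : Fin n => G r c)

/-- The support weight of a (sub)code: the number of coordinates at which some codeword
is nonzero. -/
noncomputable def supportWeight {F : Type*} [Field F] {n : ℕ}
    (D : Submodule F (Fin n → F)) : ℕ :=
  Set.ncard {c : Fin n | ∃ x ∈ D, x c ≠ 0}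

/-- The number of `r`-dimensional subcodes of `C` with support weight `i`. -/
noncomputable def supportWeightDistr {F : Type*} [Field F] {n : ℕ}
    (C : Submodule F (Fin n → F)) (r i : ℕ) : ℕ :=
  Set.ncard {D : Submodule F (Fin n → F) |
    D ≤ C ∧ Module.finrank F D = r ∧ supportWeight D = i}

/-- The `r`-th minimum support weight (`r`-th generalized Hamming weight) of `C`; the set is
nonempty precisely when `r` is at most the dimension of `C`. -/
noncomputable def minSupportWeight {F : Type*} [Field F] {n : ℕ}
    (C : Submodule F (Fin n → F)) (r : ℕ) : ℕ :=
  sInf {w : ℕ | ∃ D : Submodule F (Fin n → F),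
    D ≤ C ∧ Module.finrank F D = r ∧ supportWeight D = w}

/-- The weight hierarchy: the set of the generalized Hamming weights `d_r(C)`,
`1 ≤ r ≤ dim C`. -/
def weightHierarchy {F : Type*} [Field F] {n : ℕ}
    (C : Submodule F (Fin n → F)) : Set ℕ :=
  {w : ℕ | ∃ r : ℕ, 1 ≤ r ∧ r ≤ Module.finrank F C ∧ minSupportWeight C r = w}

/-- The Gaussian coefficient
`(q^a - 1)(q^a - q)⋯(q^a - q^(b-1)) / ((q^b - 1)(q^b - q)⋯(q^b - q^(b-1)))`,
as a rational number; it is `1` for `b = 0` and `0` for `a < b`. -/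
def gaussCoeff (q a b : ℕ) : ℚ :=
  (∏ i ∈ Finset.range b, ((q : ℚ) ^ a - (q : ℚ) ^ i)) /
    ∏ i ∈ Finset.range b, ((q : ℚ) ^ b - (q : ℚ) ^ i)

/-- `N_t(u₁, u₂, t₁, t₂)`. For `t = 0` the product and the first two Gaussian coefficients
are `1`. -/
def innerCount (q u₁ u₂ t₁ t₂ t : ℕ) : ℚ :=
  (∏ i ∈ Finset.range t, ((q : ℚ) ^ t - (q : ℚ) ^ i)) *
    gaussCoeff q (u₁ - t₁) t * gaussCoeff q (u₂ - t₂) t *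
    gaussCoeff q u₁ t₁ * gaussCoeff q u₂ t₂

/-- `N(k, m, u₁, u₂, t₁, t₂)`, by its explicit formula. The terms with `m < t + t₁ + t₂` vanish,
because a Gaussian coefficient with negative lower index is `0`. If `t₁ > u₁` or `t₂ > u₂`, the
whole sum is `0`, because a factor `gaussCoeff q u₁ t₁` or `gaussCoeff q u₂ t₂` is. -/
def outerCount (q k m u₁ u₂ t₁ t₂ : ℕ) : ℚ :=
  ∑ t ∈ Finset.range (min (u₁ - t₁) (u₂ - t₂) + 1),
    if t + t₁ + t₂ ≤ m then
      (q : ℚ) ^ ((u₁ + u₂ - (t + t₁ + t₂)) * (m - (t + t₁ + t₂))) *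
        innerCount q u₁ u₂ t₁ t₂ t *
        gaussCoeff q (k - u₁ - u₂) (m - (t + t₁ + t₂))
    else 0

end SolomonStiffler

/-!
A word of the code is the vector of values of a linear functional at the columns. The subcodes of
dimension `j` therefore correspond to the subspaces `V` of codimension `j` (take the functionals
vanishing on `V`), and `n - χ(D)` is the number of columns lying in `V`, that is
`q ^ dim V - q ^ t₁ - q ^ t₂ + 1` with `t_r = dim (V ⊓ S_r)`. As a sum `q ^ t₁ + q ^ t₂` determines
`{t₁, t₂}`, the support weight distribution counts the subspaces `V` with prescribed `t₁` and `t₂`.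

These are counted by first choosing `U = V ⊓ (S₁ ⊔ S₂)`, a subspace of `S₁ × S₂`. Once the
intersections of `U` with the two factors are fixed, `U` becomes, modulo them, a `t`-dimensional
subspace meeting both factors trivially; a basis of such a subspace is a pair of linearly
independent families. Modulo `U`, in turn, `V` becomes a subspace disjoint from the image of
`S₁ ⊔ S₂`. Finally, `d_j` is attained by a subspace in general position with respect to `S₁` and
`S₂`, obtained by intersecting `j` hyperplanes, each cutting down both intersections.
-/

open Module

namespace SolomonStiffler

section Fibers

variable {α β : Type*}

theorem ncard_eq_sum_ncard_fiber {s : Set α} (hs : s.Finite) {f : α → β} {t : Finset β}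
    (hf : Set.MapsTo f s t) : s.ncard = ∑ b ∈ t, {a ∈ s | f a = b}.ncard := by
  classical
  lift s to Finset α using hs
  rw [Set.ncard_coe_finset, Finset.card_eq_sum_card_fiberwise hf]
  refine Finset.sum_congr rfl fun b _ => ?_
  rw [← Set.ncard_coe_finset, Finset.coe_filter]
  rfl

theorem cast_ncard_eq_mul_of_fiber {s : Set α} (hs : s.Finite) {t : Set β} (ht : t.Finite)
    {f : α → β} (hf : Set.MapsTo f s t) {c : ℚ}
    (hc : ∀ b ∈ t, ({a ∈ s | f a = b}.ncard : ℚ) = c) : (s.ncard : ℚ) = t.ncard * c := by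
  lift t to Finset β using ht
  rw [ncard_eq_sum_ncard_fiber hs hf, Nat.cast_sum, Finset.sum_congr rfl hc, Finset.sum_const,
    nsmul_eq_mul, Set.ncard_coe_finset]

end Fibers

section FrameCount

/-- The number of linearly independent `b`-tuples of vectors of an `a`-dimensional space over a
field with `q` elements. Both the Gaussian coefficients and `innerCount` are built from it. -/
def frameCount (q a b : ℕ) : ℚ :=
  ∏ i ∈ Finset.range b, ((q : ℚ) ^ a - (q : ℚ) ^ i)

theorem frameCount_eq_zero (q : ℕ) {a b : ℕ} (h : a < b) : frameCount q a b = 0 :=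
  Finset.prod_eq_zero (Finset.mem_range.2 h) (sub_self _)

theorem frameCount_self_ne_zero {q : ℕ} (hq : 1 < q) (b : ℕ) : frameCount q b b ≠ 0 :=
  Finset.prod_ne_zero_iff.2 fun _ hi => sub_ne_zero.2
    (pow_lt_pow_right₀ (Nat.one_lt_cast.2 hq) (Finset.mem_range.1 hi)).ne'

theorem gaussCoeff_eq_zero (q : ℕ) {a b : ℕ} (h : a < b) : gaussCoeff q a b = 0 :=
  div_eq_zero_iff.2 (.inl (frameCount_eq_zero q h))

theorem frameCount_eq_gaussCoeff_mul {q : ℕ} (hq : 1 < q) (a b : ℕ) :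
    frameCount q a b = gaussCoeff q a b * frameCount q b b :=
  (div_mul_cancel₀ _ (frameCount_self_ne_zero hq b)).symm

theorem outerCount_eq_zero (q k m : ℕ) {u₁ u₂ t₁ t₂ : ℕ} (h : u₁ < t₁ ∨ u₂ < t₂) :
    outerCount q k m u₁ u₂ t₁ t₂ = 0 :=
  Finset.sum_eq_zero fun t _ => by
    rcases h with h | h <;> simp [innerCount, gaussCoeff_eq_zero q h]

end FrameCount

section Frames

variable {F E B : Type*} [Field F] [AddCommGroup E] [Module F E] [AddCommGroup B] [Module F B]

theorem linearIndependent_comp_iff {ι : Type*} (g : E →ₗ[F] B) (s : ι → E) :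
    LinearIndependent F (g ∘ s) ↔
      LinearIndependent F s ∧ Disjoint (Submodule.span F (Set.range s)) g.ker := by
  refine ⟨fun h => ?_, fun h => h.1.map h.2⟩
  have hs := LinearIndependent.of_comp g h
  refine ⟨hs, Submodule.disjoint_def.2 fun x hx hgx => ?_⟩
  obtain ⟨c, rfl⟩ := Finsupp.mem_span_range_iff_exists_finsupp.1 hx
  have hc : Finsupp.linearCombination F (g ∘ s) c = 0 := by
    rwa [← Finsupp.apply_linearCombination]
  rw [linearIndependent_iff.1 h c hc, Finsupp.sum_zero_index]

theorem finrank_add_finrank_ker [FiniteDimensional F E] {g : E →ₗ[F] B}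
    (hg : Function.Surjective g) : finrank F B + finrank F g.ker = finrank F E := by
  rw [← g.finrank_range_add_finrank_ker, LinearMap.range_eq_top.2 hg, finrank_top]

variable [Fintype F] [Finite E]

local notation "q" => Fintype.card F

theorem ncard_linearIndependent (m : ℕ) :
    ({s : Fin m → E | LinearIndependent F s}.ncard : ℚ) = frameCount q (finrank F E) m := by
  rw [← Nat.card_coe_set_eq]
  rcases le_or_gt m (finrank F E) with h | h
  · rw [Set.coe_ofPred, card_linearIndependent h, frameCount, Finset.prod_range, Nat.cast_prod]
    refine Finset.prod_congr rfl fun i _ => ?_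
    rw [Nat.cast_sub (Nat.pow_le_pow_right Fintype.card_pos (i.2.le.trans h)), Nat.cast_pow,
      Nat.cast_pow]
  · rw [frameCount_eq_zero q h, Nat.cast_eq_zero, Nat.card_eq_zero]
    exact .inl ⟨fun s => h.not_ge (by simpa using s.2.fintype_card_le_finrank)⟩

theorem ncard_linearIndependent_span_eq (V : Submodule F E) :
    ({s : Fin (finrank F V) → E | LinearIndependent F s ∧
      Submodule.span F (Set.range s) = V}.ncard : ℚ) =
      frameCount q (finrank F V) (finrank F V) := by
  rw [← ncard_linearIndependent, ← Set.ncard_image_of_injective _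
    (V.injective_subtype.comp_left (α := Fin (finrank F V)))]
  congr 2
  ext s
  constructor
  · rintro ⟨hs, hV⟩
    have hmem : ∀ i, s i ∈ V := fun i => hV ▸ Submodule.subset_span ⟨i, rfl⟩
    exact ⟨fun i => ⟨s i, hmem i⟩, LinearIndependent.of_comp V.subtype hs, rfl⟩
  · rintro ⟨s, hs, rfl⟩
    have hs' : LinearIndependent F (V.subtype ∘ s) := hs.map' V.subtype V.ker_subtype
    refine ⟨hs', Submodule.eq_of_le_of_finrank_eq (Submodule.span_le.2 ?_) ?_⟩
    · rintro _ ⟨i, rfl⟩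
      exact (s i).2
    · rw [finrank_span_eq_card hs', Fintype.card_fin]

theorem ncard_linearIndependent_and_span (p : Submodule F E → Prop) (m : ℕ) :
    ({s : Fin m → E | LinearIndependent F s ∧ p (Submodule.span F (Set.range s))}.ncard : ℚ) =
      {V : Submodule F E | p V ∧ finrank F V = m}.ncard * frameCount q m m := by
  refine cast_ncard_eq_mul_of_fiber (f := fun s => Submodule.span F (Set.range s))
    (Set.toFinite _) (Set.toFinite _) ?_ ?_
  · rintro s ⟨hs, hp⟩
    exact ⟨hp, by rw [finrank_span_eq_card hs, Fintype.card_fin]⟩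
  · rintro V ⟨hV, rfl⟩
    rw [← ncard_linearIndependent_span_eq]
    congr 2
    ext s
    constructor
    · rintro ⟨⟨hs, -⟩, hsV⟩
      exact ⟨hs, hsV⟩
    · rintro ⟨hs, hsV⟩
      exact ⟨⟨hs, hsV.symm ▸ hV⟩, hsV⟩

theorem ncard_fiber_linearMap {g : E →ₗ[F] B} (hg : Function.Surjective g) (b : B) :
    {x | g x = b}.ncard = q ^ finrank F g.ker := by
  rw [← Nat.card_eq_fintype_card, ← Module.natCard_eq_pow_finrank, ← Nat.card_coe_set_eq]
  exact Nat.card_congr (g.toAddMonoidHom.fiberEquivKerOfSurjective hg b)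

theorem ncard_linearIndependent_comp {g : E →ₗ[F] B} (hg : Function.Surjective g) (m : ℕ) :
    ({s : Fin m → E | LinearIndependent F (g ∘ s)}.ncard : ℚ) =
      frameCount q (finrank F B) m * (q : ℚ) ^ (m * finrank F g.ker) := by
  have : Finite B := Finite.of_surjective g hg
  have hgm : Function.Surjective (g.compLeft (Fin m)) := hg.comp_left
  have hker : finrank F (g.compLeft (Fin m)).ker = m * finrank F g.ker := by
    have h := finrank_add_finrank_ker hgm
    rw [finrank_pi_fintype, finrank_pi_fintype, ← finrank_add_finrank_ker hg] at h
    simpa [mul_add] using h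
  rw [← ncard_linearIndependent (E := B), ← hker]
  have hmaps : Set.MapsTo (g.compLeft (Fin m)) {s | LinearIndependent F (g ∘ s)}
    {s | LinearIndependent F s} := fun s hs => hs
  refine cast_ncard_eq_mul_of_fiber (Set.toFinite _) (Set.toFinite _) hmaps fun b hb => ?_
  rw [← Nat.cast_pow, ← ncard_fiber_linearMap hgm b]
  congr 2
  ext s
  exact ⟨And.right, fun h => ⟨by subst h; exact hb, h⟩⟩

theorem ncard_disjoint_finrank_eq (S : Submodule F E) (m : ℕ) :
    ({V : Submodule F E | Disjoint V S ∧ finrank F V = m}.ncard : ℚ) =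
      gaussCoeff q (finrank F E - finrank F S) m * (q : ℚ) ^ (m * finrank F S) := by
  have h := ncard_linearIndependent_comp S.mkQ_surjective m
  simp only [linearIndependent_comp_iff, Submodule.ker_mkQ] at h
  rw [ncard_linearIndependent_and_span (Disjoint · S), Submodule.ker_mkQ,
    frameCount_eq_gaussCoeff_mul Fintype.one_lt_card (finrank F (E ⧸ S)), mul_right_comm,
    S.finrank_quotient] at h
  exact mul_right_cancel₀ (frameCount_self_ne_zero Fintype.one_lt_card m) h

variable [Finite B]

theorem ncard_disjoint_ker_fst_ker_snd (t : ℕ) :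
    ({V : Submodule F (E × B) | (Disjoint V (LinearMap.fst F E B).ker ∧
      Disjoint V (LinearMap.snd F E B).ker) ∧ finrank F V = t}.ncard : ℚ) =
      frameCount q t t * gaussCoeff q (finrank F E) t * gaussCoeff q (finrank F B) t := by
  have h : {s : Fin t → E × B | LinearIndependent F s ∧
      Disjoint (Submodule.span F (Set.range s)) (LinearMap.fst F E B).ker ∧
      Disjoint (Submodule.span F (Set.range s)) (LinearMap.snd F E B).ker} =
      Equiv.arrowProdEquivProdArrow (Fin t) (fun _ => E) (fun _ => B) ⁻¹'
        ({s | LinearIndependent F s} ×ˢ {s | LinearIndependent F s}) := by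
    ext s
    change _ ↔ LinearIndependent F (LinearMap.fst F E B ∘ s) ∧
      LinearIndependent F (LinearMap.snd F E B ∘ s)
    rw [linearIndependent_comp_iff, linearIndependent_comp_iff, ← and_and_left]
    rfl
  refine mul_right_cancel₀ (frameCount_self_ne_zero (Fintype.one_lt_card (α := F)) t) ?_
  rw [← ncard_linearIndependent_and_span (fun V => Disjoint V (LinearMap.fst F E B).ker ∧
      Disjoint V (LinearMap.snd F E B).ker), h,
    Set.ncard_preimage_of_injective_subset_range (Equiv.injective _)
      (fun x _ => Equiv.surjective _ x),
    Set.ncard_prod, Nat.cast_mul, ncard_linearIndependent, ncard_linearIndependent,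
    frameCount_eq_gaussCoeff_mul Fintype.one_lt_card (finrank F E),
    frameCount_eq_gaussCoeff_mul Fintype.one_lt_card (finrank F B)]
  ring

end Frames

section Comap

variable {F E B : Type*} [Field F] [AddCommGroup E] [Module F E] [AddCommGroup B] [Module F B]

theorem comap_eq_iff_inf_range_eq {f : E →ₗ[F] B} (hf : Function.Injective f)
    {V : Submodule F B} {U : Submodule F E} : V.comap f = U ↔ V ⊓ f.range = U.map f := by
  rw [← (Submodule.map_injective_of_injective hf).eq_iff, Submodule.map_comap_eq, inf_comm]

theorem finrank_map_of_injective {f : E →ₗ[F] B} (hf : Function.Injective f)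
    (U : Submodule F E) : finrank F (U.map f) = finrank F U :=
  (Submodule.equivMapOfInjective f hf U).finrank_eq.symm

theorem finrank_comap_of_injective {f : E →ₗ[F] B} (hf : Function.Injective f)
    (V : Submodule F B) : finrank F (V.comap f) = finrank F ↥(V ⊓ f.range) := by
  rw [← finrank_map_of_injective hf, Submodule.map_comap_eq, inf_comm]

theorem finrank_comap_of_surjective [FiniteDimensional F E] {g : E →ₗ[F] B}
    (hg : Function.Surjective g) (V : Submodule F B) :
    finrank F (V.comap g) = finrank F V + finrank F g.ker := by
  have h := (g.domRestrict (V.comap g)).finrank_range_add_finrank_ker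
  rw [LinearMap.range_domRestrict, Submodule.map_comap_eq_of_surjective hg,
    LinearMap.ker_domRestrict, finrank_comap_of_injective (V.comap g).injective_subtype,
    Submodule.range_subtype, inf_eq_left.2 (LinearMap.ker_le_comap g)] at h
  exact h.symm

theorem ncard_preimage_comap {g : E →ₗ[F] B} (hg : Function.Surjective g)
    {P : Set (Submodule F E)} (hP : ∀ V ∈ P, g.ker ≤ V) :
    (Submodule.comap g ⁻¹' P).ncard = P.ncard :=
  Set.ncard_preimage_of_injective_subset_range (Submodule.comap_injective_of_surjective hg)
    fun V hV => ⟨V.map g, Submodule.comap_map_eq_self (hP V hV)⟩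

theorem finrank_add_finrank_le_finrank_inf_add [FiniteDimensional F E] (V S : Submodule F E) :
    finrank F V + finrank F S ≤ finrank F ↥(V ⊓ S) + finrank F E := by
  rw [← Submodule.finrank_sup_add_finrank_inf_eq, add_comm]
  exact Nat.add_le_add_left (Submodule.finrank_le _) _

theorem comap_mkQ_eq_iff {T : Submodule F E} {V : Submodule F (E ⧸ T)} :
    V.comap T.mkQ = T ↔ V = ⊥ := by
  rw [← (Submodule.comap_injective_of_surjective T.mkQ_surjective).eq_iff (b := ⊥),
    Submodule.comap_bot, Submodule.ker_mkQ]

variable [FiniteDimensional F E] [FiniteDimensional F B]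

theorem finrank_comap_inl_add_finrank_comap_inr_le (V : Submodule F (E × B)) :
    finrank F (V.comap (.inl F E B)) + finrank F (V.comap (.inr F E B)) ≤ finrank F V := by
  have hdisj : Disjoint (V ⊓ LinearMap.range (.inl F E B)) (V ⊓ LinearMap.range (.inr F E B)) :=
    LinearMap.isCompl_range_inl_inr.disjoint.mono inf_le_right inf_le_right
  rw [finrank_comap_of_injective LinearMap.inl_injective,
    finrank_comap_of_injective LinearMap.inr_injective, ← Submodule.finrank_sup_add_finrank_inf_eq,
    hdisj.eq_bot, finrank_bot, add_zero]
  exact Submodule.finrank_mono (sup_le inf_le_left inf_le_left)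

theorem finrank_le_finrank_comap_inl_add (V : Submodule F (E × B)) :
    finrank F V ≤ finrank F (V.comap (.inl F E B)) + finrank F B := by
  have h := finrank_add_finrank_le_finrank_inf_add V (LinearMap.range (.inl F E B))
  rw [← finrank_comap_of_injective LinearMap.inl_injective,
    LinearMap.finrank_range_of_inj LinearMap.inl_injective, finrank_prod] at h
  omega

theorem finrank_le_finrank_comap_inr_add (V : Submodule F (E × B)) :
    finrank F V ≤ finrank F (V.comap (.inr F E B)) + finrank F E := by
  have h := finrank_add_finrank_le_finrank_inf_add V (LinearMap.range (.inr F E B))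
  rw [← finrank_comap_of_injective LinearMap.inr_injective,
    LinearMap.finrank_range_of_inj LinearMap.inr_injective, finrank_prod] at h
  omega

end Comap

section SubspaceCounting

variable {F E B : Type*} [Field F] [Fintype F] [AddCommGroup E] [Module F E] [Finite E]
  [AddCommGroup B] [Module F B]

local notation "q" => Fintype.card F

theorem ncard_inf_eq_finrank_eq {U S : Submodule F E} (hU : U ≤ S) {m : ℕ}
    (hm : finrank F U ≤ m) :
    ({V : Submodule F E | V ⊓ S = U ∧ finrank F V = m}.ncard : ℚ) =
      gaussCoeff q (finrank F E - finrank F S) (m - finrank F U) *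
        (q : ℚ) ^ ((m - finrank F U) * (finrank F S - finrank F U)) := by
  have : Finite (E ⧸ U) := Module.finite_of_finite F
  have hS : (S.map U.mkQ).comap U.mkQ = S := Submodule.comap_map_eq_self (by simpa using hU)
  have hfS := finrank_comap_of_surjective U.mkQ_surjective (S.map U.mkQ)
  have hfU := U.finrank_quotient_add_finrank
  rw [hS, Submodule.ker_mkQ] at hfS
  rw [(by omega : finrank F E - finrank F S = finrank F (E ⧸ U) - finrank F (S.map U.mkQ)),
    (by omega : finrank F S - finrank F U = finrank F (S.map U.mkQ)),
    ← ncard_disjoint_finrank_eq, ← ncard_preimage_comap U.mkQ_surjective]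
  · congr 2
    ext V
    simp only [Set.mem_preimage, Set.mem_ofPred_eq]
    refine and_congr ?_ ?_
    · nth_rw 1 [← hS]
      rw [← Submodule.comap_inf, comap_mkQ_eq_iff, disjoint_iff]
    · rw [finrank_comap_of_surjective U.mkQ_surjective, Submodule.ker_mkQ]
      omega
  · rintro V ⟨rfl, -⟩
    simp

theorem ncard_finrank_eq (m : ℕ) :
    ({V : Submodule F E | finrank F V = m}.ncard : ℚ) = gaussCoeff q (finrank F E) m := by
  simpa using ncard_disjoint_finrank_eq (⊥ : Submodule F E) m

theorem ncard_comap_eq_finrank_eq {f : B →ₗ[F] E} (hf : Function.Injective f)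
    (U : Submodule F B) (m : ℕ) :
    ({V : Submodule F E | V.comap f = U ∧ finrank F V = m}.ncard : ℚ) =
      if finrank F U ≤ m then
        gaussCoeff q (finrank F E - finrank F B) (m - finrank F U) *
          (q : ℚ) ^ ((m - finrank F U) * (finrank F B - finrank F U))
      else 0 := by
  split_ifs with hm
  · have h := ncard_inf_eq_finrank_eq (LinearMap.map_le_range (f := f) (p := U)) (m := m)
    simp only [finrank_map_of_injective hf, LinearMap.finrank_range_of_inj hf,
      ← comap_eq_iff_inf_range_eq hf] at h
    exact h hm
  · rw [Nat.cast_eq_zero, Set.ncard_eq_zero, Set.eq_empty_iff_forall_notMem]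
    rintro V ⟨rfl, rfl⟩
    exact hm ((finrank_comap_of_injective hf V).trans_le (Submodule.finrank_mono inf_le_left))

variable [Finite B]

theorem ncard_comap_inl_eq_comap_inr_eq (T₁ : Submodule F E) (T₂ : Submodule F B) (t : ℕ) :
    ({V : Submodule F (E × B) | V.comap (.inl F E B) = T₁ ∧ V.comap (.inr F E B) = T₂ ∧
      finrank F V = t + finrank F T₁ + finrank F T₂}.ncard : ℚ) =
      frameCount q t t * gaussCoeff q (finrank F E - finrank F T₁) t *
        gaussCoeff q (finrank F B - finrank F T₂) t := by
  have : Finite (E ⧸ T₁) := Module.finite_of_finite F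
  have : Finite (B ⧸ T₂) := Module.finite_of_finite F
  -- Modulo `T₁ × T₂`, the subspaces to be counted are those meeting both factors trivially.
  set g : E × B →ₗ[F] (E ⧸ T₁) × (B ⧸ T₂) := T₁.mkQ.prodMap T₂.mkQ with hg
  have hs : Function.Surjective g := T₁.mkQ_surjective.prodMap T₂.mkQ_surjective
  have hker : g.ker = T₁.prod T₂ := by
    rw [hg, LinearMap.ker_prodMap, Submodule.ker_mkQ, Submodule.ker_mkQ]
  have hfker : finrank F g.ker = finrank F T₁ + finrank F T₂ := by
    have h := finrank_add_finrank_ker hs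
    have h₁ := T₁.finrank_quotient_add_finrank
    have h₂ := T₂.finrank_quotient_add_finrank
    rw [finrank_prod, finrank_prod] at h
    omega
  rw [← T₁.finrank_quotient, ← T₂.finrank_quotient, ← ncard_disjoint_ker_fst_ker_snd,
    ← ncard_preimage_comap hs]
  · congr 2
    ext V
    have h₁ : (V.comap g).comap (.inl F E B) = (V.comap (.inl F _ _)).comap T₁.mkQ := by
      ext x
      simp [hg]
    have h₂ : (V.comap g).comap (.inr F E B) = (V.comap (.inr F _ _)).comap T₂.mkQ := by
      ext x
      simp [hg]
    simp only [Set.mem_preimage, Set.mem_ofPred_eq]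
    rw [h₁, h₂, comap_mkQ_eq_iff, comap_mkQ_eq_iff, finrank_comap_of_surjective hs, hfker,
      comap_eq_iff_inf_range_eq LinearMap.inl_injective,
      comap_eq_iff_inf_range_eq LinearMap.inr_injective, Submodule.map_bot, Submodule.map_bot,
      ← LinearMap.ker_fst, ← LinearMap.ker_snd, ← disjoint_iff, ← disjoint_iff, ← and_assoc,
      and_comm (a := Disjoint V (LinearMap.ker (LinearMap.snd F _ _))), add_assoc,
      Nat.add_right_cancel_iff]
  · rintro V ⟨rfl, rfl, -⟩
    rw [hker]
    rintro ⟨x, y⟩ ⟨hx, hy⟩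
    simpa using V.add_mem hx hy

theorem ncard_finrank_comap_inl_eq_comap_inr_eq (t₁ t₂ t : ℕ) :
    ({V : Submodule F (E × B) | finrank F (V.comap (.inl F E B)) = t₁ ∧
      finrank F (V.comap (.inr F E B)) = t₂ ∧ finrank F V = t + t₁ + t₂}.ncard : ℚ) =
      innerCount q (finrank F E) (finrank F B) t₁ t₂ t := by
  have hmaps : Set.MapsTo
      (fun V : Submodule F (E × B) => (V.comap (.inl F E B), V.comap (.inr F E B)))
      {V | finrank F (V.comap (.inl F E B)) = t₁ ∧ finrank F (V.comap (.inr F E B)) = t₂ ∧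
        finrank F V = t + t₁ + t₂}
      ({T₁ : Submodule F E | finrank F T₁ = t₁} ×ˢ {T₂ : Submodule F B | finrank F T₂ = t₂}) :=
    fun V hV => ⟨hV.1, hV.2.1⟩
  rw [cast_ncard_eq_mul_of_fiber (Set.toFinite _) (Set.toFinite _) hmaps
    (c := frameCount q t t * gaussCoeff q (finrank F E - t₁) t *
      gaussCoeff q (finrank F B - t₂) t), Set.ncard_prod, Nat.cast_mul, ncard_finrank_eq,
    ncard_finrank_eq, innerCount, frameCount]
  · ring
  · rintro ⟨T₁, T₂⟩ ⟨rfl, rfl⟩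
    rw [← ncard_comap_inl_eq_comap_inr_eq]
    congr 2
    ext V
    simp only [Set.mem_ofPred_eq, Prod.mk.injEq]
    constructor
    · rintro ⟨⟨-, -, h⟩, h₁, h₂⟩
      exact ⟨h₁, h₂, h⟩
    · rintro ⟨rfl, rfl, h⟩
      exact ⟨⟨rfl, rfl, h⟩, rfl, rfl⟩

variable {A : Type*} [AddCommGroup A] [Module F A] [Finite A]

theorem ncard_finrank_comap_eq_add {f : E × B →ₗ[F] A} (hf : Function.Injective f)
    (m t₁ t₂ t : ℕ) :
    ({V : Submodule F A | (finrank F V = m ∧ finrank F ((V.comap f).comap (.inl F E B)) = t₁ ∧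
      finrank F ((V.comap f).comap (.inr F E B)) = t₂) ∧
        finrank F (V.comap f) = t + t₁ + t₂}.ncard : ℚ) =
      innerCount q (finrank F E) (finrank F B) t₁ t₂ t *
        if t + t₁ + t₂ ≤ m then
          gaussCoeff q (finrank F A - finrank F (E × B)) (m - (t + t₁ + t₂)) *
            (q : ℚ) ^ ((m - (t + t₁ + t₂)) * (finrank F (E × B) - (t + t₁ + t₂)))
        else 0 := by
  have hmaps : Set.MapsTo (Submodule.comap f)
      {V : Submodule F A | (finrank F V = m ∧ finrank F ((V.comap f).comap (.inl F E B)) = t₁ ∧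
        finrank F ((V.comap f).comap (.inr F E B)) = t₂) ∧ finrank F (V.comap f) = t + t₁ + t₂}
      {U | finrank F (U.comap (.inl F E B)) = t₁ ∧ finrank F (U.comap (.inr F E B)) = t₂ ∧
        finrank F U = t + t₁ + t₂} :=
    fun V hV => ⟨hV.1.2.1, hV.1.2.2, hV.2⟩
  rw [← ncard_finrank_comap_inl_eq_comap_inr_eq]
  refine cast_ncard_eq_mul_of_fiber (Set.toFinite _) (Set.toFinite _) hmaps ?_
  rintro U ⟨hU₁, hU₂, hU⟩
  rw [← hU, ← ncard_comap_eq_finrank_eq hf]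
  congr 2
  ext V
  constructor
  · rintro ⟨⟨⟨hV, -⟩, -⟩, hVU⟩
    exact ⟨hVU, hV⟩
  · rintro ⟨rfl, hV⟩
    exact ⟨⟨⟨hV, hU₁, hU₂⟩, rfl⟩, rfl⟩

theorem ncard_finrank_comap_comap_eq {f : E × B →ₗ[F] A} (hf : Function.Injective f)
    (m t₁ t₂ : ℕ) :
    ({V : Submodule F A | finrank F V = m ∧ finrank F ((V.comap f).comap (.inl F E B)) = t₁ ∧
      finrank F ((V.comap f).comap (.inr F E B)) = t₂}.ncard : ℚ) =
      outerCount q (finrank F A) m (finrank F E) (finrank F B) t₁ t₂ := by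
  set P := {V : Submodule F A | finrank F V = m ∧
    finrank F ((V.comap f).comap (.inl F E B)) = t₁ ∧
    finrank F ((V.comap f).comap (.inr F E B)) = t₂} with hP
  by_cases ht : finrank F E < t₁ ∨ finrank F B < t₂
  · rw [outerCount_eq_zero _ _ _ ht, Nat.cast_eq_zero, Set.ncard_eq_zero,
      Set.eq_empty_iff_forall_notMem]
    rintro V ⟨-, rfl, rfl⟩
    exact ht.elim (Submodule.finrank_le _).not_gt (Submodule.finrank_le _).not_gt
  have hle : ∀ V ∈ P, t₁ + t₂ ≤ finrank F (V.comap f) := by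
    rintro V ⟨-, rfl, rfl⟩
    exact finrank_comap_inl_add_finrank_comap_inr_le _
  have hmaps : Set.MapsTo (fun V : Submodule F A => finrank F (V.comap f) - (t₁ + t₂)) P
      (Finset.range (min (finrank F E - t₁) (finrank F B - t₂) + 1)) := by
    intro V hV
    have h₁ := finrank_le_finrank_comap_inl_add (V.comap f)
    have h₂ := finrank_le_finrank_comap_inr_add (V.comap f)
    rw [hV.2.1] at h₁
    rw [hV.2.2] at h₂
    simp only [Finset.coe_range, Set.mem_Iio]
    omega
  rw [ncard_eq_sum_ncard_fiber (Set.toFinite _) hmaps, Nat.cast_sum, outerCount]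
  refine Finset.sum_congr rfl fun t _ => ?_
  have hfiber : {V ∈ P | finrank F (V.comap f) - (t₁ + t₂) = t} =
      {V | V ∈ P ∧ finrank F (V.comap f) = t + t₁ + t₂} := by
    ext V
    refine and_congr_right fun hV => ?_
    have := hle V hV
    omega
  rw [hfiber, hP]
  refine (ncard_finrank_comap_eq_add hf m t₁ t₂ t).trans ?_
  rw [finrank_prod, Nat.sub_sub]
  split_ifs <;> ring

/-- The `m`-dimensional subspaces whose intersections with `S₁` and `S₂` have dimensions `t₁` and
`t₂`. -/
def subspacesMeeting (S₁ S₂ : Submodule F E) (m t₁ t₂ : ℕ) : Set (Submodule F E) :=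
  {V | finrank F V = m ∧ finrank F ↥(V ⊓ S₁) = t₁ ∧ finrank F ↥(V ⊓ S₂) = t₂}

theorem ncard_subspacesMeeting {S₁ S₂ : Submodule F E} (hS : Disjoint S₁ S₂) (m t₁ t₂ : ℕ) :
    ((subspacesMeeting S₁ S₂ m t₁ t₂).ncard : ℚ) =
      outerCount q (finrank F E) m (finrank F S₁) (finrank F S₂) t₁ t₂ := by
  have hinj : Function.Injective (S₁.subtype.coprod S₂.subtype) := by
    rw [← LinearMap.ker_eq_bot, LinearMap.ker_coprod_of_disjoint_range _ _ (by simpa using hS),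
      Submodule.ker_subtype, Submodule.ker_subtype, Submodule.prod_bot]
  have h₁ : ∀ V : Submodule F E, finrank F ↥(V ⊓ S₁) =
      finrank F ((V.comap (S₁.subtype.coprod S₂.subtype)).comap (.inl F S₁ S₂)) := by
    intro V
    rw [← Submodule.comap_comp, LinearMap.coprod_inl,
      finrank_comap_of_injective S₁.injective_subtype, Submodule.range_subtype]
  have h₂ : ∀ V : Submodule F E, finrank F ↥(V ⊓ S₂) =
      finrank F ((V.comap (S₁.subtype.coprod S₂.subtype)).comap (.inr F S₁ S₂)) := by
    intro V
    rw [← Submodule.comap_comp, LinearMap.coprod_inr,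
      finrank_comap_of_injective S₂.injective_subtype, Submodule.range_subtype]
  simp only [subspacesMeeting, h₁, h₂]
  exact ncard_finrank_comap_comap_eq hinj m t₁ t₂

end SubspaceCounting

section GeneralPosition

variable {F E : Type*} [Field F] [AddCommGroup E] [Module F E]

theorem exists_dual_apply_ne_zero_and {x y : E} (hx : x ≠ 0) (hy : y ≠ 0) :
    ∃ f : Dual F E, f x ≠ 0 ∧ f y ≠ 0 := by
  obtain ⟨f, hf⟩ := Projective.exists_dual_ne_zero F hx
  obtain ⟨g, hg⟩ := Projective.exists_dual_ne_zero F hy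
  by_cases hfy : f y = 0
  · by_cases hgx : g x = 0
    · exact ⟨f + g, by simpa [hgx] using hf, by simpa [hfy] using hg⟩
    · exact ⟨g, hgx, hg⟩
  · exact ⟨f, hf, hfy⟩

theorem exists_dual_not_le_ker_and {V W : Submodule F E} (hV : V ≠ ⊥) (hW : W ≠ ⊥) :
    ∃ f : Dual F E, ¬V ≤ f.ker ∧ ¬W ≤ f.ker := by
  obtain ⟨x, hxV, hx⟩ := V.exists_mem_ne_zero_of_ne_bot hV
  obtain ⟨y, hyW, hy⟩ := W.exists_mem_ne_zero_of_ne_bot hW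
  obtain ⟨f, hfx, hfy⟩ := exists_dual_apply_ne_zero_and (F := F) hx hy
  exact ⟨f, fun h => hfx (h hxV), fun h => hfy (h hyW)⟩

variable [FiniteDimensional F E]

theorem finrank_inf_ker_add_one {S : Submodule F E} {f : Dual F E} (h : ¬S ≤ f.ker) :
    finrank F ↥(S ⊓ f.ker) + 1 = finrank F S := by
  have hf : f.domRestrict S ≠ 0 := fun h0 => h fun x hx => LinearMap.congr_fun h0 ⟨x, hx⟩
  rw [← Dual.finrank_ker_add_one_of_ne_zero hf, LinearMap.ker_domRestrict,
    finrank_comap_of_injective S.injective_subtype, Submodule.range_subtype, inf_comm]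

theorem exists_dual_finrank_inf_ker {V S₁ S₂ : Submodule F E} (hV : V ≠ ⊥) (h₁ : S₁ ≤ V)
    (h₂ : S₂ ≤ V) :
    ∃ f : Dual F E, finrank F ↥(V ⊓ f.ker) + 1 = finrank F V ∧
      finrank F ↥(S₁ ⊓ f.ker) = finrank F S₁ - 1 ∧
      finrank F ↥(S₂ ⊓ f.ker) = finrank F S₂ - 1 := by
  have hdrop : ∀ S ≤ V, ∃ W ≤ V, W ≠ ⊥ ∧ ∀ f : Dual F E, ¬W ≤ f.ker →
      finrank F ↥(S ⊓ f.ker) = finrank F S - 1 := by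
    intro S hS
    rcases eq_or_ne S ⊥ with rfl | hS0
    · exact ⟨V, le_rfl, hV, fun f _ => by simp⟩
    · exact ⟨S, hS, hS0, fun f hf => Nat.eq_sub_of_add_eq (finrank_inf_ker_add_one hf)⟩
  obtain ⟨W₁, hW₁V, hW₁, hd₁⟩ := hdrop S₁ h₁
  obtain ⟨W₂, -, hW₂, hd₂⟩ := hdrop S₂ h₂
  obtain ⟨f, hf₁, hf₂⟩ := exists_dual_not_le_ker_and hW₁ hW₂
  exact ⟨f, finrank_inf_ker_add_one fun h => hf₁ (hW₁V.trans h), hd₁ f hf₁, hd₂ f hf₂⟩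

theorem exists_finrank_inf_eq_sub (S₁ S₂ : Submodule F E) {j : ℕ} (hj : j ≤ finrank F E) :
    ∃ V : Submodule F E, finrank F V + j = finrank F E ∧
      finrank F ↥(V ⊓ S₁) = finrank F S₁ - j ∧ finrank F ↥(V ⊓ S₂) = finrank F S₂ - j := by
  induction j with
  | zero => exact ⟨⊤, by rw [finrank_top, add_zero], by rw [top_inf_eq, Nat.sub_zero],
      by rw [top_inf_eq, Nat.sub_zero]⟩
  | succ j ih =>
    obtain ⟨V, hV, hV₁, hV₂⟩ := ih (Nat.le_of_succ_le hj)
    have hV0 : V ≠ ⊥ := by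
      rintro rfl
      rw [finrank_bot] at hV
      omega
    obtain ⟨f, hf, hf₁, hf₂⟩ :=
      exists_dual_finrank_inf_ker hV0 (inf_le_left (b := S₁)) (inf_le_left (b := S₂))
    refine ⟨V ⊓ f.ker, by omega, ?_, ?_⟩
    · rw [inf_right_comm, hf₁, hV₁, Nat.sub_sub]
    · rw [inf_right_comm, hf₂, hV₂, Nat.sub_sub]

end GeneralPosition

section Powers

theorem ite_lt_pow_sub {M : Type*} [Monoid M] (x : M) (j u : ℕ) :
    (if j < u then x ^ (u - j) else 1) = x ^ (u - j) := by
  split_ifs with h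
  · rfl
  · rw [Nat.sub_eq_zero_of_le (not_lt.1 h), pow_zero]

variable {x : ℕ}

theorem pow_add_pow_lt_pow_add_pow (hx : 1 < x) {a b d : ℕ} (hab : a ≤ b) (hbd : b < d) (c : ℕ) :
    x ^ a + x ^ b < x ^ c + x ^ d := by
  calc x ^ a + x ^ b ≤ x ^ b + x ^ b := Nat.add_le_add_right (Nat.pow_le_pow_right hx.le hab) _
    _ = 2 * x ^ b := (two_mul _).symm
    _ ≤ x * x ^ b := Nat.mul_le_mul_right _ hx
    _ = x ^ (b + 1) := (pow_succ' x b).symm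
    _ ≤ x ^ d := Nat.pow_le_pow_right hx.le hbd
    _ < x ^ c + x ^ d := Nat.lt_add_of_pos_left (Nat.pow_pos hx.le)

theorem pow_add_pow_eq_iff (hx : 1 < x) {s₁ s₂ t₁ t₂ : ℕ} :
    x ^ s₁ + x ^ s₂ = x ^ t₁ + x ^ t₂ ↔ s₁ = t₁ ∧ s₂ = t₂ ∨ s₁ = t₂ ∧ s₂ = t₁ := by
  refine ⟨fun h => ?_, ?_⟩
  · wlog hs : s₁ ≤ s₂ generalizing s₁ s₂
    · have := this ((add_comm _ _).trans h) (le_of_not_ge hs)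
      tauto
    wlog ht : t₁ ≤ t₂ generalizing t₁ t₂
    · have := this (h.trans (add_comm _ _)) (le_of_not_ge ht)
      tauto
    have h₂ : s₂ = t₂ := le_antisymm
      (not_lt.1 fun hlt => (pow_add_pow_lt_pow_add_pow hx ht hlt s₁).ne' h)
      (not_lt.1 fun hlt => (pow_add_pow_lt_pow_add_pow hx hs hlt t₁).ne h)
    subst h₂
    exact .inl ⟨Nat.pow_right_injective hx (Nat.add_right_cancel h), rfl⟩
  · rintro (⟨rfl, rfl⟩ | ⟨rfl, rfl⟩)
    exacts [rfl, add_comm _ _]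

theorem pow_add_pow_lt_of_le (hx : 1 < x) {u b : ℕ} (hu : u ≤ b) :
    x ^ u + x ^ b < x ^ (b + 1) + x ^ (u - 1) :=
  (pow_add_pow_lt_pow_add_pow hx hu b.lt_succ_self _).trans_eq (add_comm _ _)

theorem pow_add_pow_le_of_le_succ (hx : 1 < x) {u b : ℕ} (hu : u ≤ b + 1) :
    x ^ u + x ^ b ≤ x ^ (b + 1) + x ^ (u - 1) := by
  rcases hu.eq_or_lt with rfl | hu
  · rfl
  · exact (pow_add_pow_lt_of_le hx (Nat.le_of_lt_succ hu)).le

theorem pow_pred_add_pow_add_pow_lt (hx : 1 < x) {k u₁ u₂ : ℕ} (h₁ : u₁ < k) (h₂ : u₂ < k)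
    (hu : u₁ + u₂ ≤ k) (hexc : ¬(x = 2 ∧ k = 2 ∧ u₁ = 1 ∧ u₂ = 1)) :
    x ^ (k - 1) + x ^ u₁ + x ^ u₂ < x ^ k + x ^ (u₁ - 1) + x ^ (u₂ - 1) := by
  obtain _ | _ | b := k
  · omega
  · obtain ⟨rfl, rfl⟩ : u₁ = 0 ∧ u₂ = 0 := by omega
    simpa using Nat.succ_le_of_lt hx
  obtain ⟨y, rfl⟩ : ∃ y, x = y + 2 := Nat.exists_eq_add_of_le' hx
  have hle₁ := pow_add_pow_le_of_le_succ hx (Nat.le_of_lt_succ h₁)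
  have hle₂ := pow_add_pow_le_of_le_succ hx (Nat.le_of_lt_succ h₂)
  -- With `k = b + 2`, bounding `x ^ u₁` and `x ^ u₂` by `hle₁` and `hle₂` leaves
  -- `x ^ b * ((x - 1) * (x - 2))` to spare.
  have hquad : (y + 2) ^ (b + 1 + 1) + 2 * (y + 2) ^ b =
      3 * (y + 2) ^ (b + 1) + (y + 2) ^ b * ((y + 1) * y) := by ring
  have hstrict : (y + 2) ^ u₁ + (y + 2) ^ b < (y + 2) ^ (b + 1) + (y + 2) ^ (u₁ - 1) ∨
      (y + 2) ^ u₂ + (y + 2) ^ b < (y + 2) ^ (b + 1) + (y + 2) ^ (u₂ - 1) ∨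
      0 < (y + 2) ^ b * ((y + 1) * y) := by
    rcases y.eq_zero_or_pos with rfl | hy
    · rcases (by omega : u₁ ≤ b ∨ u₂ ≤ b) with hub | hub
      · exact .inl (pow_add_pow_lt_of_le hx hub)
      · exact .inr (.inl (pow_add_pow_lt_of_le hx hub))
    · exact .inr (.inr (by positivity))
  change (y + 2) ^ (b + 1) + _ + _ < _
  omega

end Powers

section EvaluationCode

variable {F E : Type*} [Field F] [AddCommGroup E] [Module F E] {k n : ℕ}

/-- Evaluation of linear functionals at the vectors `v c`. Its range is the code generated by a
matrix with columns `v c`, described without reference to coordinates. -/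
def evaluation (v : Fin n → E) : Dual F E →ₗ[F] (Fin n → F) :=
  LinearMap.pi fun c => Dual.eval F E (v c)

theorem range_evaluation_columns (G : Matrix (Fin k) (Fin n) F) :
    (evaluation (F := F) fun c r => G r c).range = rowCode G := by
  have h : evaluation (fun c r => G r c) ∘ₗ (dotProductEquiv F (Fin k)).toLinearMap =
      G.vecMulLinear := rfl
  rw [← LinearEquiv.range_comp (dotProductEquiv F (Fin k)), h, range_vecMulLinear]
  rfl

/-- The subcode of the words obtained from functionals vanishing on `V`. For an injective
evaluation, every subcode is of this form for exactly one `V`. -/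
def vanishingSubcode (v : Fin n → E) (V : Submodule F E) : Submodule F (Fin n → F) :=
  V.dualAnnihilator.map (evaluation v)

theorem supportWeight_vanishingSubcode_add (v : Fin n → E) (V : Submodule F E) :
    supportWeight (vanishingSubcode v V) + (v ⁻¹' V).ncard = n := by
  have h : {c | ∃ x ∈ vanishingSubcode v V, x c ≠ 0} = (v ⁻¹' V)ᶜ := by
    ext c
    rw [Set.mem_compl_iff, Set.mem_preimage, SetLike.mem_coe, Set.mem_ofPred_eq,
      ← Subspace.forall_mem_dualAnnihilator_apply_eq_zero_iff]
    push Not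
    constructor
    · rintro ⟨_, ⟨f, hf, rfl⟩, h⟩
      exact ⟨f, hf, h⟩
    · rintro ⟨f, hf, h⟩
      exact ⟨_, ⟨f, hf, rfl⟩, h⟩
  rw [supportWeight, h, add_comm, Set.ncard_add_ncard_compl, Nat.card_fin]

theorem weightHierarchy_eq_image (C : Submodule F (Fin n → F)) :
    weightHierarchy C = minSupportWeight C '' Set.Icc 1 (finrank F C) := by
  ext w
  simp only [weightHierarchy, Set.mem_ofPred_eq, Set.mem_image, Set.mem_Icc, and_assoc]

theorem vanishingSubcode_injective {v : Fin n → E}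
    (hv : Function.Injective (evaluation (F := F) v)) :
    Function.Injective (vanishingSubcode (F := F) v) :=
  (Submodule.map_injective_of_injective hv).comp fun _ _ => Subspace.dualAnnihilator_inj.1

theorem finrank_range_evaluation {v : Fin n → E}
    (hv : Function.Injective (evaluation (F := F) v)) :
    finrank F (evaluation (F := F) v).range = finrank F E := by
  rw [LinearMap.finrank_range_of_inj hv, Subspace.dual_finrank_eq]

variable [FiniteDimensional F E]

theorem bijOn_vanishingSubcode {v : Fin n → E}
    (hv : Function.Injective (evaluation (F := F) v)) (j : ℕ) :
    Set.BijOn (vanishingSubcode v) {V : Submodule F E | finrank F V + j = finrank F E}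
      {D | D ≤ (evaluation v).range ∧ finrank F D = j} := by
  have hdim : ∀ V : Submodule F E,
      finrank F V + finrank F (vanishingSubcode v V) = finrank F E := by
    intro V
    rw [vanishingSubcode, finrank_map_of_injective hv,
      Subspace.finrank_add_finrank_dualAnnihilator_eq]
  refine ⟨fun V hV => ⟨LinearMap.map_le_range, ?_⟩, (vanishingSubcode_injective hv).injOn, ?_⟩
  · exact Nat.add_left_cancel ((hdim V).trans hV.symm)
  · rintro D ⟨hD, rfl⟩
    have h : vanishingSubcode v (D.comap (evaluation v)).dualCoannihilator = D := by
      rw [vanishingSubcode, Subspace.dualCoannihilator_dualAnnihilator_eq,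
        Submodule.map_comap_eq, inf_eq_right.2 hD]
    refine ⟨_, ?_, h⟩
    have hd := hdim (D.comap (evaluation v)).dualCoannihilator
    rwa [h] at hd

theorem supportWeightDistr_range_evaluation {v : Fin n → E}
    (hv : Function.Injective (evaluation (F := F) v)) (j i : ℕ) :
    supportWeightDistr (evaluation (F := F) v).range j i =
      {V : Submodule F E | finrank F V + j = finrank F E ∧
        supportWeight (vanishingSubcode v V) = i}.ncard := by
  have hbij := (bijOn_vanishingSubcode hv j).inter_mapsTo
    (s₂ := {V | supportWeight (vanishingSubcode v V) = i}) (t₂ := {D | supportWeight D = i})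
    (fun _ hV => hV) fun _ hV => hV.2
  simp only [supportWeightDistr, ← and_assoc]
  exact hbij.ncard_eq.symm

theorem minSupportWeight_range_evaluation {v : Fin n → E}
    (hv : Function.Injective (evaluation (F := F) v)) (j : ℕ) :
    minSupportWeight (evaluation (F := F) v).range j =
      sInf ((fun V => supportWeight (vanishingSubcode v V)) ''
        {V : Submodule F E | finrank F V + j = finrank F E}) := by
  rw [← Set.image_image, (bijOn_vanishingSubcode hv j).image_eq, minSupportWeight]
  congr 1
  ext w
  simp only [Set.mem_image, Set.mem_ofPred_eq, and_assoc]

end EvaluationCode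

section ComplementOfTwoSubspaces

variable {F E : Type*} [Field F] [Fintype F] [AddCommGroup E] [Module F E] [Finite E] {n : ℕ}
  {S₁ S₂ : Submodule F E} {v : Fin n → E}

local notation "q" => Fintype.card F

theorem ncard_submodule (V : Submodule F E) : (V : Set E).ncard = q ^ finrank F V := by
  rw [← Nat.card_coe_set_eq, ← Nat.card_eq_fintype_card]
  exact Module.natCard_eq_pow_finrank

theorem ncard_union_add_one (hS : Disjoint S₁ S₂) :
    ((S₁ : Set E) ∪ S₂).ncard + 1 = q ^ finrank F S₁ + q ^ finrank F S₂ := by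
  have hinter : (S₁ ∩ S₂ : Set E) = {0} := by
    rw [← Submodule.coe_inf, hS.eq_bot, Submodule.bot_coe]
  rw [← ncard_submodule, ← ncard_submodule, ← Set.ncard_union_add_ncard_inter, hinter,
    Set.ncard_singleton]

theorem ncard_diff_union_add (hS : Disjoint S₁ S₂) (V : Submodule F E) :
    ((V : Set E) \ (S₁ ∪ S₂)).ncard + q ^ finrank F ↥(V ⊓ S₁) + q ^ finrank F ↥(V ⊓ S₂) =
      q ^ finrank F V + 1 := by
  have hunion := ncard_union_add_one (hS.mono (inf_le_right (a := V)) (inf_le_right (a := V)))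
  have hinter := Set.ncard_inter_add_ncard_sdiff_eq_ncard (V : Set E) (S₁ ∪ S₂)
  rw [Set.inter_union_distrib_left, ← Submodule.coe_inf, ← Submodule.coe_inf,
    ncard_submodule] at hinter
  omega

theorem pow_finrank_sub_le {V : Submodule F E} {j : ℕ} (hV : finrank F V + j = finrank F E)
    (S : Submodule F E) : q ^ (finrank F S - j) ≤ q ^ finrank F ↥(V ⊓ S) := by
  have := finrank_add_finrank_le_finrank_inf_add V S
  exact Nat.pow_le_pow_right Fintype.card_pos (by omega)

theorem supportWeight_vanishingSubcode_add_pow (hS : Disjoint S₁ S₂)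
    (hv : Set.BijOn v Set.univ (S₁ ∪ S₂ : Set E)ᶜ) (V : Submodule F E) :
    supportWeight (vanishingSubcode v V) + q ^ finrank F V + 1 =
      n + q ^ finrank F ↥(V ⊓ S₁) + q ^ finrank F ↥(V ⊓ S₂) := by
  have hbij : Set.BijOn v (v ⁻¹' V) ((V : Set E) \ (S₁ ∪ S₂)) := by
    refine ⟨fun c hc => ⟨hc, hv.mapsTo (Set.mem_univ c)⟩, hv.injOn.mono (Set.subset_univ _), ?_⟩
    rintro _ ⟨hxV, hx⟩
    obtain ⟨c, -, rfl⟩ := hv.surjOn hx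
    exact ⟨c, hxV, rfl⟩
  have hw := supportWeight_vanishingSubcode_add v V
  have hc := ncard_diff_union_add hS V
  rw [← hbij.ncard_eq] at hc
  omega

theorem length_add_pow_add_pow (hS : Disjoint S₁ S₂)
    (hv : Set.BijOn v Set.univ (S₁ ∪ S₂ : Set E)ᶜ) :
    n + q ^ finrank F S₁ + q ^ finrank F S₂ = q ^ finrank F E + 1 := by
  have h := supportWeight_vanishingSubcode_add_pow hS hv ⊤
  have hw := supportWeight_vanishingSubcode_add v (⊤ : Submodule F E)
  rw [Submodule.top_coe, Set.preimage_univ, Set.ncard_univ, Nat.card_fin] at hw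
  rw [top_inf_eq, top_inf_eq, finrank_top] at h
  omega

theorem evaluation_injective (hS : Disjoint S₁ S₂)
    (hv : Set.BijOn v Set.univ (S₁ ∪ S₂ : Set E)ᶜ) (h₁ : finrank F S₁ < finrank F E)
    (h₂ : finrank F S₂ < finrank F E)
    (hexc : ¬(q = 2 ∧ finrank F E = 2 ∧ finrank F S₁ = 1 ∧ finrank F S₂ = 1)) :
    Function.Injective (evaluation (F := F) v) := by
  rw [injective_iff_map_eq_zero]
  intro f hf
  by_contra hf0
  have hker := Dual.finrank_ker_add_one_of_ne_zero hf0
  have hw := supportWeight_vanishingSubcode_add v f.ker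
  have huniv : v ⁻¹' f.ker = Set.univ := Set.eq_univ_of_forall fun c => congrFun hf c
  rw [huniv, Set.ncard_univ, Nat.card_fin] at hw
  have hadd := Submodule.finrank_add_finrank_le_of_disjoint hS
  have h := supportWeight_vanishingSubcode_add_pow hS hv f.ker
  have hn := length_add_pow_add_pow hS hv
  have hlt := pow_pred_add_pow_add_pow_lt Fintype.one_lt_card h₁ h₂ hadd hexc
  rw [← hker, Nat.add_sub_cancel, hker] at hlt
  have := pow_finrank_sub_le hker S₁
  have := pow_finrank_sub_le hker S₂
  omega

theorem supportWeightDistr_eq_outerCount (hS : Disjoint S₁ S₂)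
    (hv : Set.BijOn v Set.univ (S₁ ∪ S₂ : Set E)ᶜ)
    (hinj : Function.Injective (evaluation (F := F) v)) {m j i t₁ t₂ : ℕ}
    (hm : m + j = finrank F E) (hi : i + q ^ m + 1 = n + q ^ t₁ + q ^ t₂) :
    (supportWeightDistr (evaluation (F := F) v).range j i : ℚ) =
      if t₁ = t₂ then outerCount q (finrank F E) m (finrank F S₁) (finrank F S₂) t₁ t₂
      else outerCount q (finrank F E) m (finrank F S₁) (finrank F S₂) t₁ t₂ +
        outerCount q (finrank F E) m (finrank F S₁) (finrank F S₂) t₂ t₁ := by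
  have hset : {V : Submodule F E | finrank F V + j = finrank F E ∧
      supportWeight (vanishingSubcode v V) = i} =
      subspacesMeeting S₁ S₂ m t₁ t₂ ∪ subspacesMeeting S₁ S₂ m t₂ t₁ := by
    ext V
    simp only [subspacesMeeting, Set.mem_union, Set.mem_ofPred_eq, ← and_or_left,
      ← pow_add_pow_eq_iff (Fintype.one_lt_card (α := F)), ← hm, Nat.add_right_cancel_iff]
    refine and_congr_right fun hV => ?_
    have hw := supportWeight_vanishingSubcode_add_pow hS hv V
    rw [hV] at hw
    omega
  rw [supportWeightDistr_range_evaluation hinj, hset]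
  split_ifs with ht
  · rw [ht, Set.union_self, ncard_subspacesMeeting hS]
  · have hdisj : Disjoint (subspacesMeeting S₁ S₂ m t₁ t₂) (subspacesMeeting S₁ S₂ m t₂ t₁) :=
      Set.disjoint_left.2 fun V h h' => ht (h.2.1.symm.trans h'.2.1)
    rw [Set.ncard_union_eq hdisj, Nat.cast_add, ncard_subspacesMeeting hS,
      ncard_subspacesMeeting hS]

theorem exists_of_supportWeightDistr_ne_zero (hS : Disjoint S₁ S₂)
    (hv : Set.BijOn v Set.univ (S₁ ∪ S₂ : Set E)ᶜ)
    (hinj : Function.Injective (evaluation (F := F) v)) {m j i : ℕ} (hm : m + j = finrank F E)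
    (h : supportWeightDistr (evaluation (F := F) v).range j i ≠ 0) :
    ∃ t₁ t₂, finrank F S₁ ≤ t₁ + j ∧ t₁ ≤ finrank F S₁ ∧ finrank F S₂ ≤ t₂ + j ∧
      t₂ ≤ finrank F S₂ ∧ i + q ^ m + 1 = n + q ^ t₁ + q ^ t₂ := by
  rw [supportWeightDistr_range_evaluation hinj] at h
  obtain ⟨V, hV, rfl⟩ := Set.nonempty_of_ncard_ne_zero h
  have h₁ := finrank_add_finrank_le_finrank_inf_add V S₁
  have h₂ := finrank_add_finrank_le_finrank_inf_add V S₂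
  have hw := supportWeight_vanishingSubcode_add_pow hS hv V
  rw [Nat.add_right_cancel (hV.trans hm.symm)] at hw
  exact ⟨_, _, by omega, Submodule.finrank_mono inf_le_right, by omega,
    Submodule.finrank_mono inf_le_right, hw⟩

theorem minSupportWeight_add_pow (hS : Disjoint S₁ S₂)
    (hv : Set.BijOn v Set.univ (S₁ ∪ S₂ : Set E)ᶜ)
    (hinj : Function.Injective (evaluation (F := F) v)) {m j : ℕ} (hm : m + j = finrank F E) :
    minSupportWeight (evaluation (F := F) v).range j + q ^ m + 1 =
      n + q ^ (finrank F S₁ - j) + q ^ (finrank F S₂ - j) := by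
  obtain ⟨V, hV, hV₁, hV₂⟩ := exists_finrank_inf_eq_sub S₁ S₂ (hm.symm ▸ Nat.le_add_left j m)
  have hw := supportWeight_vanishingSubcode_add_pow hS hv V
  rw [Nat.add_right_cancel (hV.trans hm.symm), hV₁, hV₂] at hw
  have hmin : IsLeast ((fun V => supportWeight (vanishingSubcode v V)) ''
      {V : Submodule F E | finrank F V + j = finrank F E})
      (supportWeight (vanishingSubcode v V)) := by
    refine ⟨⟨V, hV, rfl⟩, ?_⟩
    rintro _ ⟨W, hW, rfl⟩
    have h := supportWeight_vanishingSubcode_add_pow hS hv W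
    rw [Nat.add_right_cancel (hW.trans hm.symm)] at h
    have := pow_finrank_sub_le hW S₁
    have := pow_finrank_sub_le hW S₂
    dsimp only
    omega
  rw [minSupportWeight_range_evaluation hinj, hmin.csInf_eq, hw]

end ComplementOfTwoSubspaces

end SolomonStiffler


theorem mainTheorem4 {F : Type*} [Field F] [Fintype F] (q : ℕ) (hq : Fintype.card F = q)
    (k u₁ u₂ : ℕ) (hu₁ : u₁ < k) (hu₂ : u₂ < k)
    (hexc : ¬ (q = 2 ∧ k = 2 ∧ u₁ = 1 ∧ u₂ = 1))
    (S₁ S₂ : Submodule F (Fin k → F))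
    (hS₁ : Module.finrank F S₁ = u₁) (hS₂ : Module.finrank F S₂ = u₂)
    (hS : S₁ ⊓ S₂ = ⊥)
    (n : ℕ) (G : Matrix (Fin k) (Fin n) F)
    (hG : SolomonStiffler.IsMatrixOfSet G {x : Fin k → F | ¬ (x ∈ S₁ ∨ x ∈ S₂)})
    (C : Submodule F (Fin n → F)) (hC : C = SolomonStiffler.rowCode G) :
    -- `C` is a code of length `q^k - q^u₁ - q^u₂ + 1` and dimension `k`
    (n : ℤ) = (q : ℤ) ^ k - (q : ℤ) ^ u₁ - (q : ℤ) ^ u₂ + 1 ∧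
    Module.finrank F C = k ∧
    -- the `j`-th support weight distribution
    (∀ j : ℕ, 1 ≤ j → j ≤ k → ∀ i : ℕ, i ≤ n →
      (∀ t₁ t₂ : ℕ, max 0 ((u₁ : ℤ) - j) ≤ t₁ → t₁ ≤ u₁ → max 0 ((u₂ : ℤ) - j) ≤ t₂ → t₂ ≤ u₂ →
        (n : ℤ) - i = (q : ℤ) ^ (k - j) - (q : ℤ) ^ t₁ - (q : ℤ) ^ t₂ + 1 →
        (SolomonStiffler.supportWeightDistr C j i : ℚ) =
          if t₁ = t₂ then SolomonStiffler.outerCount q k (k - j) u₁ u₂ t₁ t₂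
          else SolomonStiffler.outerCount q k (k - j) u₁ u₂ t₁ t₂ +
            SolomonStiffler.outerCount q k (k - j) u₁ u₂ t₂ t₁) ∧
      ((¬ ∃ t₁ t₂ : ℕ, max 0 ((u₁ : ℤ) - j) ≤ t₁ ∧ t₁ ≤ u₁ ∧ max 0 ((u₂ : ℤ) - j) ≤ t₂ ∧
          t₂ ≤ u₂ ∧ (n : ℤ) - i = (q : ℤ) ^ (k - j) - (q : ℤ) ^ t₁ - (q : ℤ) ^ t₂ + 1) →
        SolomonStiffler.supportWeightDistr C j i = 0)) ∧
    -- the weight hierarchy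
    SolomonStiffler.weightHierarchy C = SolomonStiffler.minSupportWeight C '' Set.Icc 1 k ∧
    (∀ j : ℕ, 1 ≤ j → j ≤ k →
      (SolomonStiffler.minSupportWeight C j : ℤ) =
        (q : ℤ) ^ k - (q : ℤ) ^ u₁ - (q : ℤ) ^ u₂ - (q : ℤ) ^ (k - j) +
          (if j < u₁ then (q : ℤ) ^ (u₁ - j) else 1) +
          (if j < u₂ then (q : ℤ) ^ (u₂ - j) else 1)) := by
  subst hq hS₁ hS₂
  obtain rfl := hC.trans (SolomonStiffler.range_evaluation_columns G).symm
  have hdisj : Disjoint S₁ S₂ := disjoint_iff.2 hS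
  have hE : Module.finrank F (Fin k → F) = k := Module.finrank_fin_fun F
  have hinj := SolomonStiffler.evaluation_injective hdisj hG (by rwa [hE]) (by rwa [hE])
    (by rwa [hE])
  have hn := SolomonStiffler.length_add_pow_add_pow hdisj hG
  have hk := (SolomonStiffler.finrank_range_evaluation hinj).trans hE
  have hm : ∀ j ≤ k, k - j + j = Module.finrank F (Fin k → F) := fun j hj => by omega
  rw [hE] at hn
  zify at hn
  refine ⟨by linarith, hk, fun j _ hj i _ => ⟨fun t₁ t₂ _ _ _ _ hi => ?_, fun hi => ?_⟩, ?_,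
    fun j _ hj => ?_⟩
  · simpa only [hE] using SolomonStiffler.supportWeightDistr_eq_outerCount hdisj hG hinj (hm j hj)
      (by zify; linarith : i + Fintype.card F ^ (k - j) + 1 = n + _ ^ t₁ + _ ^ t₂)
  · contrapose! hi
    obtain ⟨t₁, t₂, h₁, h₁', h₂, h₂', h⟩ :=
      SolomonStiffler.exists_of_supportWeightDistr_ne_zero hdisj hG hinj (hm j hj) hi
    zify at h
    exact ⟨t₁, t₂, by omega, h₁', by omega, h₂', by linarith⟩
  · rw [SolomonStiffler.weightHierarchy_eq_image, hk]
  · have h := SolomonStiffler.minSupportWeight_add_pow hdisj hG hinj (hm j hj)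
    zify at h
    rw [SolomonStiffler.ite_lt_pow_sub, SolomonStiffler.ite_lt_pow_sub]
    linarith
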